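/- **Setting.** A *ring with involution* is a ring $R$ with an additive map $*$ satisfying $(ab)^*=b^*a^*$ and $a^{**}=a$. The involution is *formally real* if every nonempty finite sum of nonzero elements of the form $rr^*$ $(r\in R)$ is nonzero. A *unital hermitian cone* on $(R,*)$ is a set $M$ of symmetric elements ($m^*=m$) with $M+M\subseteq M$, $aMa^*\subseteq M$ for all $a\in R$, $M\cap -M=\{0\}$ and $1\in M$. Let $K/F$ be a finite Galois extension of fields with Galois group $G$ acting on $K$ from the right, $k\mapsto k^\sigma$, $k^{\sigma\tau}=(k^\sigma)^\tau$. Let $\Phi\colon G\times G\to K\setminus\{0\}$ be a normalized cocycle, i.e. $\Phi(1,\sigma)=\Phi(\sigma,1)=1$ and $\Phi(\sigma\tau,\rho)\Phi(\sigma,\tau)^\rho=\Phi(\sigma,\tau\rho)\Phi(\tau,\rho)$. Let $D=(K/F,\Phi)$ be the crossed product: the right $K$-vector space with basis $(e_\sigma)_{\sigma\in G}$ and multiplication $$\Big(\sum_\sigma e_\sigma c_\sigma\Big)\Big(\sum_\tau e_\tau d_\tau\Big)=\sum_{\sigma,\tau}e_{\sigma\tau}\Phi(\sigma,\tau)c_\sigma^\tau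 d_\tau ,$$ with $K\subseteq D$ via $k\mapsto e_1k$. Assume that $D$ is a division ring and has an involution $*$ with $K^*\subseteq K$ (then $F^*= F$ as well), and that the involution on $D\otimes_F K$ with $(d\otimes k)^*=d^*\otimes k^*$ is formally real. (Under these assumptions $e_\sigma^*e_\sigma\in K$ for all $\sigma$.) Put $a_\sigma=e_\sigma^*e_\sigma$, let $f\colon D\to K$, $f(\sum_\sigma e_\sigma c_\sigma)=c_1$, and let $\lambda\colon D\to M_G(K)$ be the left regular representation, $ue_\tau=\sum_\sigma e_\sigma\lambda(u)_{\sigma\tau}$. Let $\mathcal M$ be the set of all unital hermitian cones on $(D,*)$, and $\mathcal N$ the set of all unital hermitian cones on $(K,*)$ that contain $a_\sigma$ for every $\sigma\in G$. For $N\in\mathcal N$, $\sigma\in G$ and $M\in\mathcal M$ put $$N_\sigma=\Big\{\Big(\frac{n}{a_\sigma}\Big)^{\sigma^{-1}} : n\in N\Big\},\qquad M^c=M\cap K,$$ $$N^e=\{u\in D : A\lambda(u)\text{ is hermitian and } x^*A\lambda(u)x\in N\text{ for every } x\in K^G\},\quad A=\operatorname{diag}(a_\sigma)_{\sigma\in G}.$$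 **Theorem.** For every $N\in\mathcal N$ one has $N_\sigma\in\mathcal N$ for every $\sigma\in G$, $N^e\in\mathcal M$, and 1. $N^e=\{u\in D : u^*=u \text{ and } f(d^*ud)\in N\text{ for every }d\in D\}$, 2. $N^{ec}=\bigcap_{\sigma\in G}N_\sigma$, 3. $(N_\sigma)^e=N^e$ for every $\sigma\in G$, 4. $N^{ece}=N^e$. For every $M\in\mathcal M$ one has $M^c\in\mathcal N$, and 5. $(M^c)_\sigma=M^c$ for every $\sigma\in G$, 6. $M^{cec}=M^c$. -/

import Mathlib

open scoped TensorProduct Matrix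

/-! ### Rings with involution, unital hermitian cones -/

/-- The involution of `R` is formally real if every (nonempty) finite sum of nonzero elements of
the form `r * star r` is nonzero. -/
def IsFormallyRealInvolution (R : Type*) [Ring R] [StarRing R] : Prop :=
  ∀ (n : ℕ) (r : Fin (n + 1) → R), (∀ i, r i * star (r i) ≠ 0) → ∑ i, r i * star (r i) ≠ 0

/-- A unital hermitian cone on a ring with involution: a set `M` of symmetric elements with
`M + M ⊆ M`, `a M a* ⊆ M` for all `a`, `M ∩ -M = {0}` and `1 ∈ M`. -/
structure IsUnitalHermitianCone {R : Type*} [Ring R] [StarRing R] (M : Set R) : Prop where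
  star_eq : ∀ m ∈ M, star m = m
  add_mem : ∀ m ∈ M, ∀ m' ∈ M, m + m' ∈ M
  conj_mem : ∀ a : R, ∀ m ∈ M, a * m * star a ∈ M
  inter_neg : M ∩ {m | -m ∈ M} = {0}
  one_mem : (1 : R) ∈ M

/-! ### Crossed products

The Galois group acts on `K` from the right, `k ^ σ = σ k`, so the product `σ τ` of the Galois
group is "first `σ`, then `τ`", which is `σ.trans τ`. -/

/-- A normalized 2-cocycle of `Gal(K/F)` with values in `K \ {0}`. -/
structure NormalizedCocycle (F K : Type*) [Field F] [Field K] [Algebra F K] where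
  toFun : Gal(K/F) → Gal(K/F) → K
  ne_zero : ∀ σ τ, toFun σ τ ≠ 0
  one_left : ∀ σ, toFun 1 σ = 1
  one_right : ∀ σ, toFun σ 1 = 1
  cocycle : ∀ σ τ ρ : Gal(K/F),
    toFun (σ.trans τ) ρ * ρ (toFun σ τ) = toFun σ (τ.trans ρ) * toFun τ ρ

/-- The crossed product `(K/F, Φ)`; `⟨c⟩` is the element `∑ σ, e_σ c_σ`. -/
@[ext]
structure CrossedProduct {F K : Type*} [Field F] [Field K] [Algebra F K]
    (Φ : NormalizedCocycle F K) where
  coeff : Gal(K/F) → K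

noncomputable section

namespace CrossedProduct

variable {F K : Type*} [Field F] [Field K] [Algebra F K] {Φ : NormalizedCocycle F K}

instance : Zero (CrossedProduct Φ) := ⟨⟨0⟩⟩
instance : Add (CrossedProduct Φ) := ⟨fun u v => ⟨u.coeff + v.coeff⟩⟩
instance : Neg (CrossedProduct Φ) := ⟨fun u => ⟨-u.coeff⟩⟩

@[simp] theorem coeff_zero : (0 : CrossedProduct Φ).coeff = 0 := rfl
@[simp] theorem coeff_add (u v : CrossedProduct Φ) : (u + v).coeff = u.coeff + v.coeff := rfl
@[simp] theorem coeff_neg (u : CrossedProduct Φ) : (-u).coeff = -u.coeff := rfl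

instance : AddCommGroup (CrossedProduct Φ) where
  add_assoc u v w := by ext; simp [add_assoc]
  zero_add u := by ext; simp
  add_zero u := by ext; simp
  add_comm u v := by ext; simp [add_comm]
  neg_add_cancel u := by ext; simp
  nsmul := nsmulRec
  zsmul := zsmulRec

open Classical in
/-- The element `e_σ c`. -/
def single (σ : Gal(K/F)) (c : K) : CrossedProduct Φ := ⟨Pi.single σ c⟩

/-- The basis element `e_σ`. -/
def e (σ : Gal(K/F)) : CrossedProduct Φ := single σ 1

theorem single_add (σ : Gal(K/F)) (c d : K) :
    (single σ (c + d) : CrossedProduct Φ) = single σ c + single σ d := by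
  ext : 1
  simp [single, Pi.single_add]

theorem single_zero (σ : Gal(K/F)) : (single σ 0 : CrossedProduct Φ) = 0 := by
  ext : 1
  simp [single]

/-- `coeff` as an additive homomorphism. -/
def coeffHom : CrossedProduct Φ →+ (Gal(K/F) → K) where
  toFun := coeff
  map_zero' := rfl
  map_add' _ _ := rfl

theorem coeff_sum {ι : Type*} (s : Finset ι) (g : ι → CrossedProduct Φ) :
    (∑ i ∈ s, g i).coeff = ∑ i ∈ s, (g i).coeff := map_sum coeffHom g s

instance : One (CrossedProduct Φ) := ⟨single 1 1⟩

theorem one_def : (1 : CrossedProduct Φ) = single 1 1 := rfl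

variable [FiniteDimensional F K]

theorem sum_single (u : CrossedProduct Φ) : ∑ σ, single σ (u.coeff σ) = u := by
  classical
  apply CrossedProduct.ext
  rw [coeff_sum]
  simp only [single]
  exact Finset.univ_sum_single u.coeff

/-- `(∑ e_σ c_σ) (∑ e_τ d_τ) = ∑ e_{σ τ} Φ(σ, τ) c_σ ^ τ d_τ`. -/
instance : Mul (CrossedProduct Φ) :=
  ⟨fun u v => ∑ σ, ∑ τ, single (σ.trans τ) (Φ.toFun σ τ * τ (u.coeff σ) * v.coeff τ)⟩

theorem mul_def (u v : CrossedProduct Φ) :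
    u * v = ∑ σ, ∑ τ, single (σ.trans τ) (Φ.toFun σ τ * τ (u.coeff σ) * v.coeff τ) := rfl

protected theorem add_mul' (u v w : CrossedProduct Φ) : (u + v) * w = u * w + v * w := by
  simp [mul_def, mul_add, add_mul, single_add, Finset.sum_add_distrib]

protected theorem mul_add' (u v w : CrossedProduct Φ) : u * (v + w) = u * v + u * w := by
  simp [mul_def, mul_add, single_add, Finset.sum_add_distrib]

theorem single_mul_single (σ τ : Gal(K/F)) (c d : K) :
    (single σ c : CrossedProduct Φ) * single τ d
      = single (σ.trans τ) (Φ.toFun σ τ * τ c * d) := by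
  classical
  rw [mul_def, Finset.sum_eq_single σ, Finset.sum_eq_single τ]
  · simp [single]
  · intro ρ _ h
    have hc : (single τ d : CrossedProduct Φ).coeff ρ = 0 := by simp [single, h]
    rw [hc, mul_zero, single_zero]
  · simp
  · intro ρ _ h
    have hc : (single σ c : CrossedProduct Φ).coeff ρ = 0 := by simp [single, h]
    simp only [hc, map_zero, mul_zero, zero_mul, single_zero, Finset.sum_const_zero]
  · simp

theorem induction_on {p : CrossedProduct Φ → Prop} (u : CrossedProduct Φ)
    (single : ∀ σ c, p (single σ c)) (add : ∀ u v, p u → p v → p (u + v)) : p u := by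
  have h0 : p 0 := by
    have := single 1 0
    rwa [single_zero] at this
  rw [← sum_single u]
  exact Finset.sum_induction _ p add h0 fun σ _ => single σ _

instance : Ring (CrossedProduct Φ) where
  __ := (inferInstance : AddCommGroup (CrossedProduct Φ))
  left_distrib := CrossedProduct.mul_add'
  right_distrib := CrossedProduct.add_mul'
  zero_mul u := by simp [mul_def, single_zero]
  mul_zero u := by simp [mul_def, single_zero]
  one_mul u := by
    induction u using induction_on with
    | single σ c =>
      rw [one_def, single_mul_single, Φ.one_left]
      simp only [map_one, one_mul]
      rfl
    | add u v hu hv => rw [CrossedProduct.mul_add', hu, hv]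
  mul_one u := by
    induction u using induction_on with
    | single σ c =>
      rw [one_def, single_mul_single, Φ.one_right]
      simp only [one_mul, mul_one]
      rfl
    | add u v hu hv => rw [CrossedProduct.add_mul', hu, hv]
  mul_assoc u v w := by
    induction u using induction_on with
    | add u u' hu hu' => simp only [CrossedProduct.add_mul', hu, hu']
    | single σ c =>
      induction v using induction_on with
      | add v v' hv hv' => simp only [CrossedProduct.add_mul', CrossedProduct.mul_add', hv, hv']
      | single τ d =>
        induction w using induction_on with
        | add w w' hw hw' => simp only [CrossedProduct.mul_add', hw, hw']
        | single ρ x =>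
          simp only [single_mul_single]
          have h := Φ.cocycle σ τ ρ
          have h2 : (τ.trans ρ) c = ρ (τ c) := rfl
          congr 1
          rw [map_mul, map_mul, h2]
          linear_combination ρ (τ c) * ρ d * x * h

/-- The embedding of `K` into the crossed product, `k ↦ e_1 k`. -/
def ofK (Φ : NormalizedCocycle F K) : K →+* CrossedProduct Φ where
  toFun k := single 1 k
  map_one' := rfl
  map_zero' := single_zero 1
  map_add' := single_add 1
  map_mul' c d := by
    rw [single_mul_single, Φ.one_left]
    simp only [one_mul]
    rfl

theorem e_mul_ofK (σ : Gal(K/F)) (c : K) : e σ * ofK Φ c = single σ c := by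
  simp only [e, ofK, RingHom.coe_mk, MonoidHom.coe_mk, OneHom.coe_mk, single_mul_single,
    Φ.one_right, map_one, one_mul]
  rfl

theorem ofK_mul_e (σ : Gal(K/F)) (c : K) : ofK Φ c * e σ = e σ * ofK Φ (σ c) := by
  rw [e_mul_ofK]
  simp only [e, ofK, RingHom.coe_mk, MonoidHom.coe_mk, OneHom.coe_mk, single_mul_single,
    Φ.one_left, one_mul, mul_one]
  rfl

/-- The crossed product is an algebra over `F ⊆ K`. -/
instance : Algebra F (CrossedProduct Φ) :=
  ((ofK Φ).comp (algebraMap F K)).toAlgebra' fun r u => by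
    induction u using induction_on with
    | add u v hu hv => rw [mul_add, add_mul, hu, hv]
    | single σ c =>
      rw [← e_mul_ofK, RingHom.comp_apply, ← mul_assoc, ofK_mul_e, AlgEquiv.commutes, mul_assoc,
        mul_assoc, ← map_mul, ← map_mul, mul_comm]

/-- The `K`-`K`-bilinear projection `f : D → K`, `f (∑ e_σ c_σ) = c_1`. -/
def f (u : CrossedProduct Φ) : K := u.coeff 1

/-- The left regular representation with respect to the right `K`-basis `e`: the matrix with
`u e_τ = ∑ σ, e_σ (regRep u)_{σ τ}`. -/
def regRep (u : CrossedProduct Φ) : Matrix Gal(K/F) Gal(K/F) K :=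
  Matrix.of fun σ τ => (u * e τ).coeff σ

variable (Φ) [StarRing (CrossedProduct Φ)]

/-- `a_σ = e_σ* e_σ`, as an element of `K`. -/
def a (σ : Gal(K/F)) : K :=
  f (star (e σ : CrossedProduct Φ) * e σ)

/-- The set of all unital hermitian cones on `K` which contain all `e_σ* e_σ`. -/
def cones [StarRing K] : Set (Set K) :=
  {N | IsUnitalHermitianCone N ∧
    ∀ σ : Gal(K/F), star (e σ : CrossedProduct Φ) * e σ ∈ ofK Φ '' N}

/-- `N_σ = {(n / a_σ) ^ (σ⁻¹) | n ∈ N}`. -/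
def translate (N : Set K) (σ : Gal(K/F)) : Set K :=
  (fun n => σ⁻¹ (n / a Φ σ)) '' N

/-- `M^c = M ∩ K`. -/
def contraction {Φ : NormalizedCocycle F K} (M : Set (CrossedProduct Φ)) : Set K := ofK Φ ⁻¹' M

open Classical in
/-- `N^e`: all `u` such that the matrix `A λ(u)`, where `A = diag(a_σ)`, is hermitian and satisfies
`x* A λ(u) x ∈ N` for every column `x`. -/
def extension [StarRing K] (N : Set K) : Set (CrossedProduct Φ) :=
  {u | (Matrix.diagonal (a Φ) * regRep u).IsHermitian ∧
    ∀ x : Gal(K/F) → K, star x ⬝ᵥ ((Matrix.diagonal (a Φ) * regRep u) *ᵥ x) ∈ N}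

end CrossedProduct

end

/-! ### Formally real involutions -/

/-! Formal reality serves only to make `*` commute with the Galois group on `K`. It descends to `K ⊗
K ⊆ D ⊗ K`, where each `σ` has a nonzero idempotent `p` that identifies `1 ⊗ σ s` with `s ⊗ 1`. If
`*` and `σ` did not commute, `p` and `p*` would be orthogonal, and `p ± p*` would contradict formal
reality.

Consequently `e_σ*` lies in `e_{σ⁻¹} K`, and the basis `e` is orthogonal for the hermitian form `f
(d* w)`, with Gram matrix `A` (`f_star_mul`). So `A λ(u)` is the matrix of `d ↦ f (d* u d)`, which
is claim 1 (`extension_eq`).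

The rest uses `a_σ σ(k) = e_σ* k e_σ`: membership of `k` in `N_σ` means that this conjugate lies in
`N`. For `u = k` in `K` the form is diagonal with entries `a_σ σ(k)`, giving claim 2. The
substitution `d ↦ d e_σ` gives 3, and 4 follows since extension commutes with intersections.
Conjugation by the unit `e_σ` preserves `M`, giving 5, and 2 with 5 gives 6. -/

theorem IsFormallyRealInvolution.of_injective {A B : Type*} [Ring A] [StarRing A] [Ring B]
    [StarRing B] (h : IsFormallyRealInvolution B) (g : A →+* B) (hg : Function.Injective g)
    (hstar : ∀ x, g (star x) = star (g x)) : IsFormallyRealInvolution A := by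
  intro n r hr hsum
  refine h n (fun i => g (r i)) (fun i hi => hr i (hg ?_)) ?_
  · rw [map_mul, hstar, hi, map_zero]
  · simpa [hstar] using congrArg g hsum

/-- In a commutative ring with formally real involution, a nonzero idempotent is not orthogonal to
its conjugate. -/
theorem IsFormallyRealInvolution.eq_zero_of_mul_star_eq_zero {A : Type*} [CommRing A] [StarRing A]
    (h : IsFormallyRealInvolution A) {p : A} (hp : p * p = p) (hps : p * star p = 0) : p = 0 := by
  by_contra h0
  have hps' : star p * star p = star p := by rw [← star_mul, hp]
  have hq : p + star p ≠ 0 := fun hq => h0 <| by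
    have : p * (p + star p) = 0 := by rw [hq, mul_zero]
    rwa [mul_add, hp, hps, add_zero] at this
  have e0 : (p + star p) * star (p + star p) = p + star p := by
    rw [star_add, star_star]; linear_combination hp + hps' + 2 * hps
  have e1 : (p - star p) * star (p - star p) = -(p + star p) := by
    rw [star_sub, star_star]; linear_combination -hp - hps' + 2 * hps
  -- Two summands, with values `p + p*` and `-(p + p*)`.
  refine h 1 ![p + star p, p - star p] (Fin.forall_fin_two.2 ⟨?_, ?_⟩) ?_
  · rwa [Matrix.cons_val_zero, e0]
  · rwa [Matrix.cons_val_one, Matrix.cons_val_fin_one, e1, neg_ne_zero]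
  · refine (Fin.sum_univ_two _).trans ?_
    rw [Matrix.cons_val_zero, Matrix.cons_val_one, Matrix.cons_val_fin_one, e0, e1, add_neg_cancel]

/-! ### Idempotents of `K ⊗ K` and commutation of `*` with the Galois group. -/

section Galois

variable {F K : Type*} [Field F] [Field K] [Algebra F K] [FiniteDimensional F K] [IsGalois F K]

/-- The idempotent of `K ⊗ K` corresponding to an automorphism of `K`. -/
theorem exists_idempotent_tmul_mul (σ : Gal(K/F)) :
    ∃ p : K ⊗[F] K, p ≠ 0 ∧ p * p = p ∧ ∀ s, ((1 : K) ⊗ₜ[F] σ s) * p = (s ⊗ₜ[F] (1 : K)) * p := by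
  have := Algebra.FormallyUnramified.of_isSeparable F K
  set t := Algebra.FormallyUnramified.elem F K
  have ht0 : t ≠ 0 := fun h0 => by
    have := Algebra.FormallyUnramified.lmul_elem (R := F) (S := K)
    rw [show Algebra.FormallyUnramified.elem F K = 0 from h0, map_zero] at this
    exact zero_ne_one this
  have hmul : ∀ x : K ⊗[F] K, x * t = (Algebra.TensorProduct.lmul' F x ⊗ₜ[F] (1 : K)) * t := by
    intro x
    induction x with
    | zero => simp
    | add x y hx hy => rw [add_mul, hx, hy, map_add, TensorProduct.add_tmul, add_mul]
    | tmul x y =>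
      have h1 : x ⊗ₜ[F] y = (x ⊗ₜ[F] (1 : K)) * ((1 : K) ⊗ₜ[F] y) := by simp
      have h2 : (x * y) ⊗ₜ[F] (1 : K) = (x ⊗ₜ[F] (1 : K)) * (y ⊗ₜ[F] (1 : K)) := by simp
      rw [Algebra.TensorProduct.lmul'_apply_tmul, h1, h2, mul_assoc, mul_assoc,
        Algebra.FormallyUnramified.one_tmul_mul_elem]
  -- The separability idempotent `t` satisfies `(1 ⊗ s) t = (s ⊗ 1) t`; applying `id ⊗ σ` twists
  -- this relation by `σ`.
  let g := Algebra.TensorProduct.congr (AlgEquiv.refl (R := F) (A₁ := K)) σ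
  refine ⟨g t, fun h => ht0 (g.injective (by rw [h, map_zero])), ?_, fun s => ?_⟩
  · rw [← map_mul, hmul t, show Algebra.TensorProduct.lmul' F t = 1 from
      Algebra.FormallyUnramified.lmul_elem, ← Algebra.TensorProduct.one_def, one_mul]
  · have h := congrArg g (Algebra.FormallyUnramified.one_tmul_mul_elem (R := F) s)
    rw [map_mul, map_mul] at h
    simpa [g] using h

/-- If the involution on `K ⊗ K` is formally real then the involution of `K` commutes with the
Galois group. -/
theorem star_galois_apply_of_isFormallyReal [StarRing F] [StarRing K] [StarModule F K]
    (h : IsFormallyRealInvolution (K ⊗[F] K)) (σ : Gal(K/F)) (k : K) :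
    star (σ k) = σ (star k) := by
  by_contra hk
  obtain ⟨p, hp0, hpp, hp⟩ := exists_idempotent_tmul_mul σ
  refine hp0 (h.eq_zero_of_mul_star_eq_zero hpp ?_)
  have hs := congrArg star (hp k)
  rw [star_mul', star_mul', TensorProduct.star_tmul, TensorProduct.star_tmul, star_one] at hs
  -- On `p p*`, both `1 ⊗ (σ k)*` and `1 ⊗ σ(k*)` act as `k* ⊗ 1`.
  have hd : ((1 : K) ⊗ₜ[F] (star (σ k) - σ (star k))) * (p * star p) = 0 := by
    rw [TensorProduct.tmul_sub]
    linear_combination p * hs - star p * hp (star k)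
  have hu : ((1 : K) ⊗ₜ[F] (star (σ k) - σ (star k))⁻¹) *
      ((1 : K) ⊗ₜ[F] (star (σ k) - σ (star k))) = 1 := by
    rw [Algebra.TensorProduct.tmul_mul_tmul, mul_one, inv_mul_cancel₀ (sub_ne_zero.2 hk),
      Algebra.TensorProduct.one_def]
  rw [← one_mul (p * star p), ← hu, mul_assoc, hd, mul_zero]

end Galois

/-! ### Coordinates, the regular representation and the basis elements. -/

noncomputable section

namespace CrossedProduct

variable {F K : Type*} [Field F] [Field K] [Algebra F K] {Φ : NormalizedCocycle F K}

theorem coeff_single_self (σ : Gal(K/F)) (c : K) : (single σ c : CrossedProduct Φ).coeff σ = c := by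
  simp [single]

theorem coeff_single_of_ne {σ τ : Gal(K/F)} (h : τ ≠ σ) (c : K) :
    (single σ c : CrossedProduct Φ).coeff τ = 0 := by
  simp [single, h]

theorem f_add (u v : CrossedProduct Φ) : f (u + v) = f u + f v := rfl

theorem f_neg (u : CrossedProduct Φ) : f (-u) = -f u := rfl

theorem e_one : (e 1 : CrossedProduct Φ) = 1 := rfl

variable [FiniteDimensional F K]

theorem f_ofK (k : K) : f (ofK Φ k) = k := coeff_single_self 1 k

theorem ofK_injective : Function.Injective (ofK Φ) :=
  Function.LeftInverse.injective f_ofK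

theorem coeff_mul_ofK (u : CrossedProduct Φ) (k : K) (τ : Gal(K/F)) :
    (u * ofK Φ k).coeff τ = u.coeff τ * k := by
  classical
  induction u using induction_on with
  | add u v hu hv => rw [add_mul, coeff_add, Pi.add_apply, hu, hv, coeff_add, Pi.add_apply, add_mul]
  | single σ c =>
    rw [← e_mul_ofK, mul_assoc, ← map_mul, e_mul_ofK, e_mul_ofK]
    by_cases h : τ = σ
    · subst h; simp only [coeff_single_self]
    · simp only [coeff_single_of_ne h, zero_mul]

theorem coeff_ofK_mul (u : CrossedProduct Φ) (k : K) (τ : Gal(K/F)) :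
    (ofK Φ k * u).coeff τ = τ k * u.coeff τ := by
  classical
  induction u using induction_on with
  | add u v hu hv => rw [mul_add, coeff_add, Pi.add_apply, hu, hv, coeff_add, Pi.add_apply, mul_add]
  | single σ c =>
    rw [← e_mul_ofK, ← mul_assoc, ofK_mul_e, mul_assoc, ← map_mul, e_mul_ofK, e_mul_ofK]
    by_cases h : τ = σ
    · subst h; simp only [coeff_single_self]
    · simp only [coeff_single_of_ne h, mul_zero]

theorem f_ofK_mul (k : K) (u : CrossedProduct Φ) : f (ofK Φ k * u) = k * f u :=
  coeff_ofK_mul u k 1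

theorem f_mul_ofK (u : CrossedProduct Φ) (k : K) : f (u * ofK Φ k) = f u * k :=
  coeff_mul_ofK u k 1

/-- The elements that move past `K` as `e ρ` does are the multiples of `e ρ`. -/
theorem eq_single_of_ofK_mul {x : CrossedProduct Φ} {ρ : Gal(K/F)}
    (h : ∀ k, ofK Φ k * x = x * ofK Φ (ρ k)) : x = single ρ (x.coeff ρ) := by
  ext τ
  by_cases hτ : τ = ρ
  · subst hτ; rw [coeff_single_self]
  · rw [coeff_single_of_ne hτ]
    by_contra hx
    -- In the `τ`-coordinate, `h k` says `τ k * c = c * ρ k`, so `c ≠ 0` forces `τ = ρ`.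
    refine hτ (AlgEquiv.ext fun k => ?_)
    have := congrArg (fun u => u.coeff τ) (h k)
    simp only [coeff_ofK_mul, coeff_mul_ofK] at this
    rw [mul_comm] at this
    exact mul_left_cancel₀ hx this

theorem coeff_mul_eq_regRep_mulVec (u d : CrossedProduct Φ) :
    (u * d).coeff = regRep u *ᵥ d.coeff := by
  ext σ
  conv_lhs => rw [← sum_single d, Finset.mul_sum, coeff_sum, Finset.sum_apply]
  simp only [Matrix.mulVec, dotProduct, regRep, Matrix.of_apply]
  refine Finset.sum_congr rfl fun τ _ => ?_
  rw [← e_mul_ofK, ← mul_assoc, coeff_mul_ofK]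

theorem e_mul_e (σ τ : Gal(K/F)) :
    (e σ * e τ : CrossedProduct Φ) = e (σ.trans τ) * ofK Φ (Φ.toFun σ τ) := by
  rw [e_mul_ofK, e, e, single_mul_single, map_one, mul_one, mul_one]

/-- `e_τ e_{τ⁻¹}` is a nonzero cocycle value in `K`. Taking `τ = σ` gives a right inverse, `τ = σ⁻¹`
a left one. -/
theorem isUnit_e (σ : Gal(K/F)) : IsUnit (e σ : CrossedProduct Φ) := by
  have key : ∀ τ : Gal(K/F), IsUnit (e τ * e τ⁻¹ : CrossedProduct Φ) := fun τ => by
    rw [e_mul_e, show τ.trans τ⁻¹ = 1 from inv_mul_cancel τ, e_one, one_mul]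
    exact (IsUnit.mk0 _ (Φ.ne_zero _ _)).map (ofK Φ)
  obtain ⟨v, hv⟩ := (key σ).exists_right_inv
  obtain ⟨w, hw⟩ := (key σ⁻¹).exists_left_inv
  rw [inv_inv] at hw
  refine isUnit_iff_exists_and_exists.2 ⟨⟨e σ⁻¹ * v, ?_⟩, ⟨w * e σ⁻¹, ?_⟩⟩
  · rw [← mul_assoc, hv]
  · rw [mul_assoc, hw]

theorem a_one [StarRing (CrossedProduct Φ)] : a Φ 1 = 1 := by
  rw [a, e_one, star_one, mul_one]; exact f_ofK 1

/-! ### The involution -/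

section Star

variable [StarRing K] [StarRing (CrossedProduct Φ)]
  (hstar : ∀ k : K, star (ofK Φ k) = ofK Φ (star k))
  (hcomm : ∀ (σ : Gal(K/F)) (k : K), star (σ k) = σ (star k))

include hstar hcomm

theorem star_e_mul_ofK (σ : Gal(K/F)) (k : K) :
    star (e σ) * ofK Φ k = ofK Φ (σ k) * star (e σ) := by
  have h := congrArg star (ofK_mul_e (Φ := Φ) σ (star k))
  rwa [star_mul, star_mul, hstar, hstar, hcomm, star_star] at h

theorem exists_star_e_eq_single (σ : Gal(K/F)) :
    ∃ c, star (e σ : CrossedProduct Φ) = single σ⁻¹ c :=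
  ⟨_, eq_single_of_ofK_mul fun k => by
    rw [star_e_mul_ofK hstar hcomm, ← AlgEquiv.mul_apply, mul_inv_cancel, AlgEquiv.one_apply]⟩

/-- The product commutes with `K`, and `K` is its own centralizer, so only the coordinate at `1`
survives. -/
theorem star_e_mul_e (σ : Gal(K/F)) : star (e σ : CrossedProduct Φ) * e σ = ofK Φ (a Φ σ) := by
  refine eq_single_of_ofK_mul (ρ := 1) fun k => ?_
  obtain ⟨l, rfl⟩ := σ.surjective k
  rw [← mul_assoc, ← star_e_mul_ofK hstar hcomm, mul_assoc, ofK_mul_e, ← mul_assoc,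
    AlgEquiv.one_apply]

theorem a_ne_zero (σ : Gal(K/F)) : a Φ σ ≠ 0 := fun h0 => by
  have h := (isUnit_e (Φ := Φ) σ).star.mul (isUnit_e σ)
  rw [star_e_mul_e hstar hcomm, h0, map_zero, isUnit_zero_iff] at h
  exact zero_ne_one (ofK_injective (Φ := Φ) (by rw [map_zero, map_one, h]))

theorem star_a (σ : Gal(K/F)) : star (a Φ σ) = a Φ σ := by
  apply ofK_injective (Φ := Φ)
  rw [← hstar, ← star_e_mul_e hstar hcomm, star_mul, star_star]

theorem star_e_mul_ofK_mul_e (σ : Gal(K/F)) (k : K) :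
    star (e σ) * ofK Φ k * e σ = ofK Φ (a Φ σ * σ k) := by
  rw [mul_assoc, ofK_mul_e, ← mul_assoc, star_e_mul_e hstar hcomm, map_mul]

/-- `a_σ a_τ ^ σ = Φ(τ, σ)* a_{τ σ} Φ(τ, σ)`. -/
theorem a_mul_apply_a (σ τ : Gal(K/F)) :
    a Φ σ * σ (a Φ τ) = Φ.toFun τ σ * a Φ (τ.trans σ) * star (Φ.toFun τ σ) := by
  apply ofK_injective (Φ := Φ)
  rw [← star_e_mul_ofK_mul_e hstar hcomm, ← star_e_mul_e hstar hcomm]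
  have h : star (e τ * e σ : CrossedProduct Φ) * (e τ * e σ)
      = ofK Φ (star (Φ.toFun τ σ)) * (ofK Φ (a Φ (τ.trans σ)) * ofK Φ (Φ.toFun τ σ)) := by
    rw [e_mul_e, star_mul, hstar, ← star_e_mul_e hstar hcomm]
    simp only [mul_assoc]
  rw [star_mul] at h
  rw [mul_assoc, mul_assoc, ← mul_assoc, ← mul_assoc, mul_assoc (star (e σ)), mul_assoc,
    mul_assoc (star (e τ)), ← mul_assoc, h, ← map_mul, ← map_mul]
  congr 1
  ring

/-- Orthogonality of the basis: for `τ ≠ σ`, `e_σ* e_τ` is supported at an index other than `1`. -/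
theorem f_star_e_mul (σ : Gal(K/F)) (v : CrossedProduct Φ) :
    f (star (e σ) * v) = a Φ σ * v.coeff σ := by
  induction v using induction_on with
  | add u v hu hv => rw [mul_add, f_add, hu, hv, coeff_add, Pi.add_apply, mul_add]
  | single τ c =>
    by_cases h : σ = τ
    · subst h
      rw [coeff_single_self, ← e_mul_ofK, ← mul_assoc, star_e_mul_e hstar hcomm, ← map_mul, f_ofK]
    · obtain ⟨x, hx⟩ := exists_star_e_eq_single hstar hcomm σ
      rw [coeff_single_of_ne h, mul_zero, hx, single_mul_single]
      exact coeff_single_of_ne (fun h1 => h (mul_inv_eq_one.1 h1.symm).symm) _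

theorem f_star (v : CrossedProduct Φ) : f (star v) = star (f v) := by
  induction v using induction_on with
  | add u v hu hv => rw [star_add, f_add, f_add, hu, hv, star_add]
  | single τ c =>
    by_cases h : τ = 1
    · subst h
      rw [← e_mul_ofK, e_one, one_mul, hstar, f_ofK, f_ofK]
    · obtain ⟨x, hx⟩ := exists_star_e_eq_single hstar hcomm τ
      have h0 : f (single τ c : CrossedProduct Φ) = 0 := coeff_single_of_ne (Ne.symm h) _
      have h1 : f (single τ⁻¹ x : CrossedProduct Φ) = 0 :=
        coeff_single_of_ne (fun h1 => h (inv_eq_one.1 h1.symm)) _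
      rw [h0, ← e_mul_ofK, star_mul, hstar, hx, f_ofK_mul, h1, mul_zero, star_zero]

theorem f_star_e_mul_mul_e (σ : Gal(K/F)) (v : CrossedProduct Φ) :
    f (star (e σ) * v * e σ) = a Φ σ * σ (f v) := by
  induction v using induction_on with
  | add u v hu hv => rw [mul_add, add_mul, f_add, hu, hv, f_add, map_add, mul_add]
  | single τ c =>
    by_cases h : τ = 1
    · subst h
      rw [← e_mul_ofK, e_one, one_mul, star_e_mul_ofK_mul_e hstar hcomm, f_ofK, f_ofK]
    · have h0 : f (single τ c : CrossedProduct Φ) = 0 := coeff_single_of_ne (Ne.symm h) _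
      rw [h0, map_zero, mul_zero, mul_assoc, f_star_e_mul hstar hcomm, e, single_mul_single,
        coeff_single_of_ne, mul_zero]
      exact fun h1 => h (mul_eq_left.1 (h1.symm : σ * τ = σ))

theorem f_star_mul (d w : CrossedProduct Φ) :
    f (star d * w) = ∑ σ, star (d.coeff σ) * (a Φ σ * w.coeff σ) := by
  have hf : ∀ g : Gal(K/F) → CrossedProduct Φ, f (∑ σ, g σ) = ∑ σ, f (g σ) := fun g => by
    simp only [f, coeff_sum, Finset.sum_apply]
  conv_lhs => rw [← sum_single d, star_sum, Finset.sum_mul, hf]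
  refine Finset.sum_congr rfl fun σ _ => ?_
  rw [← e_mul_ofK, star_mul, hstar, mul_assoc, f_ofK_mul, f_star_e_mul hstar hcomm]

/-- The hermitian form of the matrix `A λ(u)` is `d ↦ f (d* u d)`. -/
theorem extension_eq (N : Set K) : extension Φ N =
    {u | star u = u ∧ ∀ d : CrossedProduct Φ, f (star d * u * d) ∈ N} := by
  classical
  have hform : ∀ u d : CrossedProduct Φ, star d.coeff ⬝ᵥ
      ((Matrix.diagonal (a Φ) * regRep u) *ᵥ d.coeff) = f (star d * u * d) := fun u d => by
    rw [mul_assoc, f_star_mul hstar hcomm, ← Matrix.mulVec_mulVec, ← coeff_mul_eq_regRep_mulVec]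
    simp only [dotProduct, Matrix.mulVec_diagonal, Pi.star_apply]
  have hgram : ∀ (u : CrossedProduct Φ) (σ τ : Gal(K/F)),
      (Matrix.diagonal (a Φ) * regRep u) σ τ = f (star (e σ) * (u * e τ)) := fun u σ τ => by
    rw [Matrix.diagonal_mul, f_star_e_mul hstar hcomm]; rfl
  ext u
  have hherm : (Matrix.diagonal (a Φ) * regRep u).IsHermitian ↔ star u = u := by
    rw [Matrix.IsHermitian.ext_iff]
    have hs : ∀ σ τ, star ((Matrix.diagonal (a Φ) * regRep u) σ τ)
        = f (star (e τ) * (star u * e σ)) := fun σ τ => by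
      rw [hgram, ← f_star hstar hcomm, star_mul, star_mul, star_star, mul_assoc]
    constructor
    · intro h
      ext σ
      -- The column of `e_1 = 1` suffices: it gives all coordinates of `u* ` and `u`, scaled by the
      -- nonzero `a_σ`.
      have := h σ 1
      rw [hs, hgram, f_star_e_mul hstar hcomm, f_star_e_mul hstar hcomm, e_one, mul_one,
        mul_one] at this
      exact mul_left_cancel₀ (a_ne_zero hstar hcomm σ) this
    · intro h σ τ
      rw [hs, hgram, h]
  refine and_congr hherm ⟨fun h d => ?_, fun h x => ?_⟩
  · rw [← hform]; exact h d.coeff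
  · have := h ⟨x⟩
    rwa [← hform] at this

theorem mem_extension {N : Set K} {u : CrossedProduct Φ} : u ∈ extension Φ N ↔
    star u = u ∧ ∀ d : CrossedProduct Φ, f (star d * u * d) ∈ N := by
  rw [extension_eq hstar hcomm]; rfl

theorem mem_translate {N : Set K} {σ : Gal(K/F)} {k : K} :
    k ∈ translate Φ N σ ↔ a Φ σ * σ k ∈ N := by
  have ha := a_ne_zero hstar hcomm (Φ := Φ) σ
  constructor
  · rintro ⟨n, hn, rfl⟩
    change a Φ σ * σ (σ⁻¹ (n / a Φ σ)) ∈ N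
    rw [← AlgEquiv.mul_apply, mul_inv_cancel, AlgEquiv.one_apply, mul_div_cancel₀ _ ha]
    exact hn
  · intro h
    refine ⟨_, h, ?_⟩
    change σ⁻¹ (a Φ σ * σ k / a Φ σ) = k
    rw [mul_div_cancel_left₀ _ ha, ← AlgEquiv.mul_apply, inv_mul_cancel, AlgEquiv.one_apply]

theorem mem_cones {N : Set K} :
    N ∈ cones Φ ↔ IsUnitalHermitianCone N ∧ ∀ σ : Gal(K/F), a Φ σ ∈ N := by
  refine and_congr_right fun _ => forall_congr' fun σ => ?_
  rw [star_e_mul_e hstar hcomm]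
  exact ofK_injective.mem_set_image

end Star

end CrossedProduct

end

/-! ### General facts on unital hermitian cones. -/

namespace IsUnitalHermitianCone

variable {R : Type*} [Ring R] [StarRing R] {M : Set R}

theorem zero_mem (hM : IsUnitalHermitianCone M) : (0 : R) ∈ M :=
  (hM.inter_neg.symm ▸ Set.mem_singleton (0 : R) : (0 : R) ∈ M ∩ {m | -m ∈ M}).1

theorem eq_zero_of_mem_of_neg_mem (hM : IsUnitalHermitianCone M) {m : R} (h : m ∈ M)
    (h' : -m ∈ M) : m = 0 :=
  (hM.inter_neg ▸ (⟨h, h'⟩ : m ∈ M ∩ {m | -m ∈ M}) : m ∈ ({0} : Set R))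

theorem of_eq_zero (star_eq : ∀ m ∈ M, star m = m) (add_mem : ∀ m ∈ M, ∀ m' ∈ M, m + m' ∈ M)
    (conj_mem : ∀ a : R, ∀ m ∈ M, a * m * star a ∈ M)
    (eq_zero : ∀ m ∈ M, -m ∈ M → m = 0) (one_mem : (1 : R) ∈ M) : IsUnitalHermitianCone M where
  star_eq := star_eq
  add_mem := add_mem
  conj_mem := conj_mem
  inter_neg := Set.Subset.antisymm (fun m hm => eq_zero m hm.1 hm.2) <| by
    have h0 : (0 : R) ∈ M := by simpa using conj_mem 0 1 one_mem
    rintro _ rfl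
    exact ⟨h0, by simpa using h0⟩
  one_mem := one_mem

theorem sum_mem (hM : IsUnitalHermitianCone M) {ι : Type*} (s : Finset ι) (g : ι → R)
    (hg : ∀ i ∈ s, g i ∈ M) : ∑ i ∈ s, g i ∈ M :=
  Finset.sum_induction g (· ∈ M) (fun _ _ hx hy => hM.add_mem _ hx _ hy) hM.zero_mem hg

/-- If `2 = 0`, then `-1 = 1` would lie in `M ∩ -M`. -/
theorem two_ne_zero [Nontrivial R] (hM : IsUnitalHermitianCone M) : (2 : R) ≠ 0 := fun h =>
  one_ne_zero <| hM.eq_zero_of_mem_of_neg_mem hM.one_mem <| by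
    rw [neg_eq_of_add_eq_zero_left (one_add_one_eq_two.trans h)]; exact hM.one_mem

theorem conj_mem_iff (hM : IsUnitalHermitianCone M) {a : R} (ha : IsUnit a) {m : R} :
    star a * m * a ∈ M ↔ m ∈ M := by
  refine ⟨fun h => ?_, fun h => by simpa using hM.conj_mem (star a) m h⟩
  obtain ⟨u, rfl⟩ := ha
  have := hM.conj_mem (star (↑u⁻¹ : R)) _ h
  rwa [star_star, ← mul_assoc, ← mul_assoc, ← star_mul, Units.mul_inv, star_one, one_mul,
    mul_assoc, Units.mul_inv, mul_one] at this

end IsUnitalHermitianCone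

/-! ### Translation, extension and contraction of cones. -/

namespace CrossedProduct

variable {F K : Type*} [Field F] [Field K] [Algebra F K] {Φ : NormalizedCocycle F K}
  [FiniteDimensional F K] [StarRing K] [StarRing (CrossedProduct Φ)]
  (hstar : ∀ k : K, star (ofK Φ k) = ofK Φ (star k))
  (hcomm : ∀ (σ : Gal(K/F)) (k : K), star (σ k) = σ (star k))

include hstar hcomm

theorem translate_mem_cones {N : Set K} (hN : N ∈ cones Φ) (σ : Gal(K/F)) :
    translate Φ N σ ∈ cones Φ := by
  rw [mem_cones hstar hcomm] at hN ⊢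
  obtain ⟨hN, ha⟩ := hN
  have ha0 := a_ne_zero hstar hcomm (Φ := Φ) σ
  refine ⟨.of_eq_zero ?_ ?_ ?_ ?_ ?_, fun τ => ?_⟩ <;> simp only [mem_translate hstar hcomm]
  · intro k hk
    have := hN.star_eq _ hk
    rw [star_mul', star_a hstar hcomm, hcomm] at this
    exact σ.injective (mul_left_cancel₀ ha0 this)
  · intro k hk l hl
    rw [map_add, mul_add]
    exact hN.add_mem _ hk _ hl
  · intro c k hk
    have := hN.conj_mem (σ c) _ hk
    rwa [hcomm, mul_left_comm, mul_assoc, ← map_mul, ← map_mul] at this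
  · intro k hk hk'
    rw [map_neg, mul_neg] at hk'
    have := hN.eq_zero_of_mem_of_neg_mem hk hk'
    simpa [ha0] using this
  · rw [map_one, mul_one]
    exact ha σ
  -- By the cocycle identity, `a_σ σ(a_τ)` is a conjugate of another `a_ρ`.
  · rw [a_mul_apply_a hstar hcomm]
    exact hN.conj_mem _ _ (ha _)

/-- Polarization at `1 + d` shows that `f (u d)` is skew. Scaling `d` by `f (u d)*` turns this into
`2 f (u d) f (u d)* = 0`, and nondegeneracy of the form finishes. It gives `N^e ∩ -N^e = {0}`. -/
theorem eq_zero_of_f_star_mul_mul_eq_zero (h2 : (2 : K) ≠ 0) {u : CrossedProduct Φ}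
    (hu : star u = u) (h : ∀ d : CrossedProduct Φ, f (star d * u * d) = 0) : u = 0 := by
  have hpol : ∀ d : CrossedProduct Φ, f (u * d) + star (f (u * d)) = 0 := fun d => by
    have h1 := h (1 + d)
    have h3 := h 1
    have h4 := h d
    have e1 : star (1 + d) * u * (1 + d)
        = star (1 : CrossedProduct Φ) * u * 1 + star d * u * d + (u * d + star (u * d)) := by
      rw [star_mul, hu, star_add, star_one]; noncomm_ring
    rwa [e1, f_add, f_add, h3, h4, f_add, f_star hstar hcomm, zero_add, zero_add] at h1
  have hf : ∀ d : CrossedProduct Φ, f (u * d) = 0 := fun d => by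
    have := hpol (d * ofK Φ (star (f (u * d))))
    rw [← mul_assoc, f_mul_ofK, star_mul', star_star, mul_comm (star _), ← two_mul] at this
    simpa [h2] using this
  ext σ
  have h2 := f_star hstar hcomm (star (e σ) * u)
  rw [star_mul, star_star, hu, hf, eq_comm, star_eq_zero, f_star_e_mul hstar hcomm] at h2
  exact (mul_eq_zero.1 h2).resolve_left (a_ne_zero hstar hcomm σ)

theorem isUnitalHermitianCone_extension {N : Set K} (hN : N ∈ cones Φ) :
    IsUnitalHermitianCone (extension Φ N) := by
  rw [mem_cones hstar hcomm] at hN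
  obtain ⟨hN, ha⟩ := hN
  refine .of_eq_zero ?_ ?_ ?_ ?_ ?_ <;> simp only [mem_extension hstar hcomm]
  · exact fun u hu => hu.1
  · refine fun u hu v hv => ⟨by rw [star_add, hu.1, hv.1], fun d => ?_⟩
    rw [mul_add, add_mul, f_add]
    exact hN.add_mem _ (hu.2 d) _ (hv.2 d)
  · refine fun b u hu => ⟨by rw [star_mul, star_mul, hu.1, star_star, mul_assoc], fun d => ?_⟩
    have := hu.2 (star b * d)
    rw [star_mul, star_star] at this
    simpa only [mul_assoc] using this
  · refine fun u hu hu' => eq_zero_of_f_star_mul_mul_eq_zero hstar hcomm hN.two_ne_zero hu.1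
      fun d => hN.eq_zero_of_mem_of_neg_mem (hu.2 d) ?_
    have := hu'.2 d
    rwa [mul_neg, neg_mul, f_neg] at this
  -- `f (d* d)` is the diagonal form with entries `a_σ`; this is where `a_σ ∈ N` is needed.
  · refine ⟨star_one _, fun d => ?_⟩
    rw [mul_one, f_star_mul hstar hcomm]
    refine hN.sum_mem _ _ fun σ _ => ?_
    have := hN.conj_mem (star (d.coeff σ)) _ (ha σ)
    rwa [star_star, mul_assoc] at this

theorem contraction_extension_eq {N : Set K} (hN : IsUnitalHermitianCone N) :
    contraction (extension Φ N) = ⋂ σ : Gal(K/F), translate Φ N σ := by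
  ext k
  rw [contraction, Set.mem_preimage, mem_extension hstar hcomm, Set.mem_iInter, hstar]
  simp only [mem_translate hstar hcomm]
  constructor
  · rintro ⟨-, h⟩ σ
    have := h (e σ)
    rwa [star_e_mul_ofK_mul_e hstar hcomm, f_ofK] at this
  · refine fun h => ⟨?_, fun d => ?_⟩
    · have := hN.star_eq _ (h 1)
      rw [a_one, one_mul, AlgEquiv.one_apply] at this
      rw [this]
    · rw [mul_assoc, f_star_mul hstar hcomm]
      refine hN.sum_mem _ _ fun σ _ => ?_
      have := hN.conj_mem (star (d.coeff σ)) _ (h σ)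
      rwa [star_star, mul_assoc, mul_assoc, ← coeff_ofK_mul] at this

theorem extension_translate (N : Set K) (σ : Gal(K/F)) :
    extension Φ (translate Φ N σ) = extension Φ N := by
  ext u
  simp only [mem_extension hstar hcomm, mem_translate hstar hcomm]
  have key : ∀ d : CrossedProduct Φ, a Φ σ * σ (f (star d * u * d))
      = f (star (d * e σ) * u * (d * e σ)) := fun d => by
    rw [← f_star_e_mul_mul_e hstar hcomm, star_mul]
    simp only [mul_assoc]
  refine and_congr_right fun _ => ⟨fun h d => ?_, fun h d => ?_⟩
  · obtain ⟨v, hv⟩ := (isUnit_e (Φ := Φ) σ).exists_left_inv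
    -- Right multiplication by `e_σ` is onto: `d = (d v) e_σ`.
    have := h (d * v)
    rwa [key, mul_assoc d, hv, mul_one] at this
  · rw [key]; exact h _

/-- The index type must be nonempty because the condition `u* = u` would be lost in an empty
intersection on the right. -/
theorem extension_iInter {ι : Type*} [Nonempty ι] (N : ι → Set K) :
    extension Φ (⋂ i, N i) = ⋂ i, extension Φ (N i) := by
  ext u
  simp only [mem_extension hstar hcomm, Set.mem_iInter]
  rw [forall_and, forall_const, forall_comm]

theorem extension_contraction_extension {N : Set K} (hN : IsUnitalHermitianCone N) :
    extension Φ (contraction (extension Φ N)) = extension Φ N := by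
  rw [contraction_extension_eq hstar hcomm hN, extension_iInter hstar hcomm]
  simp only [extension_translate hstar hcomm, Set.iInter_const]

theorem contraction_mem_cones {M : Set (CrossedProduct Φ)} (hM : IsUnitalHermitianCone M) :
    contraction M ∈ cones Φ := by
  rw [mem_cones hstar hcomm]
  refine ⟨.of_eq_zero ?_ ?_ ?_ ?_ ?_, fun σ => ?_⟩ <;>
    simp only [contraction, Set.mem_preimage]
  · intro k hk
    apply ofK_injective (Φ := Φ)
    rw [← hstar, hM.star_eq _ hk]
  · intro k hk l hl
    rw [map_add]; exact hM.add_mem _ hk _ hl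
  · intro c k hk
    rw [map_mul, map_mul, ← hstar]; exact hM.conj_mem _ _ hk
  · intro k hk hk'
    rw [map_neg] at hk'
    exact ofK_injective (Φ := Φ) ((hM.eq_zero_of_mem_of_neg_mem hk hk').trans (map_zero _).symm)
  · rw [map_one]; exact hM.one_mem
  · rw [← star_e_mul_e hstar hcomm, ← mul_one (star (e σ)), hM.conj_mem_iff (isUnit_e σ)]
    exact hM.one_mem

theorem translate_contraction {M : Set (CrossedProduct Φ)} (hM : IsUnitalHermitianCone M)
    (σ : Gal(K/F)) : translate Φ (contraction M) σ = contraction M := by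
  ext k
  rw [mem_translate hstar hcomm, contraction, Set.mem_preimage, Set.mem_preimage,
    ← star_e_mul_ofK_mul_e hstar hcomm, hM.conj_mem_iff (isUnit_e σ)]

theorem contraction_extension_contraction {M : Set (CrossedProduct Φ)}
    (hM : IsUnitalHermitianCone M) :
    contraction (extension Φ (contraction M)) = contraction M := by
  have hN := ((mem_cones hstar hcomm).1 (contraction_mem_cones hstar hcomm hM)).1
  rw [contraction_extension_eq hstar hcomm hN]
  simp only [translate_contraction hstar hcomm hM, Set.iInter_const]

end CrossedProduct

/-! ### Descent from `D ⊗ K` to `K ⊗ K`, and the theorem. -/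

namespace CrossedProduct

variable {F K : Type*} [Field F] [Field K] [Algebra F K] [FiniteDimensional F K] [IsGalois F K]
  {Φ : NormalizedCocycle F K} [StarRing F] [StarRing K] [StarModule F K]
  [StarRing (CrossedProduct Φ)] [StarModule F (CrossedProduct Φ)]

/-- The embedding of `K` as an algebra homomorphism. -/
noncomputable def ofKAlgHom (Φ : NormalizedCocycle F K) : K →ₐ[F] CrossedProduct Φ where
  __ := ofK Φ
  commutes' _ := rfl

theorem star_galois_apply (hstar : ∀ k : K, star (ofK Φ k) = ofK Φ (star k))
    (hreal : IsFormallyRealInvolution (CrossedProduct Φ ⊗[F] K)) (σ : Gal(K/F)) (k : K) :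
    star (σ k) = σ (star k) := by
  refine star_galois_apply_of_isFormallyReal (hreal.of_injective
    (Algebra.TensorProduct.map (ofKAlgHom Φ) (AlgHom.id F K)).toRingHom ?_ fun x => ?_) σ k
  -- `K` is flat over the field `F`, so `K ⊗ K → D ⊗ K` stays injective.
  · exact Module.Flat.rTensor_preserves_injective_linearMap (ofKAlgHom Φ).toLinearMap
      (ofK_injective (Φ := Φ))
  · induction x with
    | zero => simp
    | add x y hx hy => simp only [star_add, map_add, hx, hy]
    | tmul x y =>
      change ofK Φ (star x) ⊗ₜ[F] star y = star (ofK Φ x ⊗ₜ[F] y)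
      rw [TensorProduct.star_tmul, hstar]

end CrossedProduct

theorem mainTheorem6 {F K : Type*} [Field F] [Field K] [Algebra F K]
    [FiniteDimensional F K] [IsGalois F K]
    (Φ : NormalizedCocycle F K)
    (hdiv : ∀ u : CrossedProduct Φ, u ≠ 0 → IsUnit u)
    [StarRing F] [StarRing K] [StarModule F K]
    [StarRing (CrossedProduct Φ)] [StarModule F (CrossedProduct Φ)]
    (hstar : ∀ k : K, star (CrossedProduct.ofK Φ k) = CrossedProduct.ofK Φ (star k))
    (hreal : IsFormallyRealInvolution (CrossedProduct Φ ⊗[F] K)) :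
    (∀ N ∈ CrossedProduct.cones Φ,
      -- the objects in the claims are of the right kind
      (∀ σ : Gal(K/F), CrossedProduct.translate Φ N σ ∈ CrossedProduct.cones Φ) ∧
      IsUnitalHermitianCone (CrossedProduct.extension Φ N) ∧
      -- the claims about `N`
      CrossedProduct.extension Φ N =
        {u | star u = u ∧ ∀ d : CrossedProduct Φ, CrossedProduct.f (star d * u * d) ∈ N} ∧
      CrossedProduct.contraction (CrossedProduct.extension Φ N) =
        (⋂ σ : Gal(K/F), CrossedProduct.translate Φ N σ) ∧
      (∀ σ : Gal(K/F), CrossedProduct.extension Φ (CrossedProduct.translate Φ N σ) =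
        CrossedProduct.extension Φ N) ∧
      CrossedProduct.extension Φ
          (CrossedProduct.contraction (CrossedProduct.extension Φ N)) =
        CrossedProduct.extension Φ N) ∧
    (∀ M : Set (CrossedProduct Φ), IsUnitalHermitianCone M →
      CrossedProduct.contraction M ∈ CrossedProduct.cones Φ ∧
      (∀ σ : Gal(K/F), CrossedProduct.translate Φ (CrossedProduct.contraction M) σ =
        CrossedProduct.contraction M) ∧
      CrossedProduct.contraction
          (CrossedProduct.extension Φ (CrossedProduct.contraction M)) =
        CrossedProduct.contraction M) := by
  have hcomm := CrossedProduct.star_galois_apply hstar hreal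
  refine ⟨fun N hN => ?_, fun M hM => ⟨CrossedProduct.contraction_mem_cones hstar hcomm hM,
    CrossedProduct.translate_contraction hstar hcomm hM,
    CrossedProduct.contraction_extension_contraction hstar hcomm hM⟩⟩
  exact ⟨CrossedProduct.translate_mem_cones hstar hcomm hN,
    CrossedProduct.isUnitalHermitianCone_extension hstar hcomm hN,
    CrossedProduct.extension_eq hstar hcomm N,
    CrossedProduct.contraction_extension_eq hstar hcomm hN.1,
    CrossedProduct.extension_translate hstar hcomm N,
    CrossedProduct.extension_contraction_extension hstar hcomm hN.1⟩
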